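/- A monotone circuit on $n$ Boolean variables is a finite directed acyclic graph of AND and OR gates of unbounded fan-in (no negations) whose gates are fed by variables and by other gates, with one variable or gate designated as the output; its size is its number of gates (variables are not counted) and its depth is the largest number of gates on a directed path. Let $\mathrm{Maj}_n(x)=1$ if and only if more than $n/2$ of the bits of $x\in\{0,1\}^n$ are $1$. An $(\varepsilon,n)$-Approximate Majority is a function $f:\{0,1\}^n\to\{0,1\}$ such that $\Pr_{x}[f(x)\neq \mathrm{Maj}_n(x)]\le\varepsilon$ for uniformly random $x\in\{0,1\}^n$. **Theorem.** There are absolute constants $c>0$ and $K>0$ such that for all integers $n\ge 3$ and $d$ with $$2\le d\le c\,\frac{\log n}{\log\log n}$$ and every real $\varepsilon>0$, there is an $(\varepsilon,n)$-Approximate Majority that is computed by a monotone circuit of depth at most $d$ with at most $$\exp\!\left(K\, n^{\frac{1}{2(d-1)}}\cdot\frac{\log(1/\varepsilon)}{\varepsilon}\right)$$ gates. -/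

import Mathlib

/-- The Majority function: value `1` exactly when more than half of the bits are `1`. -/
def majority (n : ℕ) (x : Fin n → Bool) : Bool :=
  decide (n < 2 * (Finset.univ.filter fun i => x i = true).card)

/-- `f` disagrees with Majority with probability at most `ε` on a uniformly random input
of `{0,1}^n`. -/
def IsApproxMajority (ε : ℝ) (n : ℕ) (f : (Fin n → Bool) → Bool) : Prop :=
  ((Finset.univ.filter fun x : Fin n → Bool => f x ≠ majority n x).card : ℝ) / 2 ^ n ≤ ε

/-- The two gate types of a monotone circuit. -/
inductive GateKind where
  | and
  | or

/-- A monotone Boolean circuit on `n` variables with AND and OR gates of unbounded fan-in: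
a finite directed acyclic graph of gates. A node is a variable `Sum.inl i` or a gate `Sum.inr g`,
and any node may be designated as the output. Gates may be shared (arbitrary fan-out).
An AND (OR) gate of fan-in zero is the constant `1` (`0`). -/
structure MonotoneCircuit (n : ℕ) where
  /-- the gates (variables are not gates) -/
  Gate : Type
  fintypeGate : Fintype Gate
  kind : Gate → GateKind
  /-- the nodes that feed into a gate -/
  inputs : Gate → Finset (Fin n ⊕ Gate)
  acyclic : WellFounded fun h g : Gate => Sum.inr h ∈ inputs g
  output : Fin n ⊕ Gate

namespace MonotoneCircuit

attribute [instance] MonotoneCircuit.fintypeGate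

variable {n : ℕ} (C : MonotoneCircuit n)

/-- The value that a gate of the given kind computes from the values of the nodes feeding it. -/
noncomputable def gateValue {ι : Type} (k : GateKind) (v : ι → Bool) : Bool :=
  open Classical in
  match k with
  | GateKind.and => decide (∀ w, v w = true)
  | GateKind.or => decide (∃ w, v w = true)

/-- The value of a gate on the input `x`, by recursion along the wires. -/
noncomputable def evalGate (x : Fin n → Bool) : C.Gate → Bool :=
  C.acyclic.fix fun g ih =>
    gateValue (C.kind g) fun w : {w // w ∈ C.inputs g} =>
      match w with
      | ⟨Sum.inl i, _⟩ => x i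
      | ⟨Sum.inr h, hw⟩ => ih h hw

/-- The value of a node on the input `x`. -/
noncomputable def evalNode (x : Fin n → Bool) : Fin n ⊕ C.Gate → Bool :=
  Sum.elim x (C.evalGate x)

/-- The Boolean function computed by the circuit. -/
noncomputable def eval (x : Fin n → Bool) : Bool :=
  C.evalNode x C.output

/-- The largest number of gates on a directed path that ends in the given gate. -/
noncomputable def gateDepth : C.Gate → ℕ :=
  C.acyclic.fix fun g ih =>
    ((C.inputs g).attach.sup fun w =>
      match w with
      | ⟨Sum.inl _, _⟩ => 0
      | ⟨Sum.inr h, hw⟩ => ih h hw) + 1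

/-- The depth of a node; variables have depth `0`. -/
noncomputable def nodeDepth : Fin n ⊕ C.Gate → ℕ :=
  Sum.elim (fun _ => 0) C.gateDepth

/-- The depth of the circuit: the largest number of gates on a directed path. -/
noncomputable def depth : ℕ :=
  Finset.univ.sup C.gateDepth

/-- The size of the circuit: its number of gates. -/
def size : ℕ :=
  Fintype.card C.Gate

theorem evalGate_eq (x : Fin n → Bool) (g : C.Gate) :
    C.evalGate x g =
      gateValue (C.kind g) fun w : {w // w ∈ C.inputs g} => C.evalNode x w.1 := by
  rw [evalGate, WellFounded.fix_eq]
  congr 1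
  funext w
  rcases w with ⟨i | h, hw⟩ <;> rfl

theorem evalGate_and (x : Fin n → Bool) (g : C.Gate) (hg : C.kind g = GateKind.and) :
    C.evalGate x g = true ↔ ∀ w ∈ C.inputs g, C.evalNode x w = true := by
  rw [evalGate_eq, hg]
  simp [gateValue]

theorem evalGate_or (x : Fin n → Bool) (g : C.Gate) (hg : C.kind g = GateKind.or) :
    C.evalGate x g = true ↔ ∃ w ∈ C.inputs g, C.evalNode x w = true := by
  rw [evalGate_eq, hg]
  simp [gateValue]

theorem gateDepth_eq (g : C.Gate) :
    C.gateDepth g = ((C.inputs g).sup C.nodeDepth) + 1 := by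
  rw [← Finset.sup_attach (C.inputs g) C.nodeDepth, gateDepth, WellFounded.fix_eq]
  congr 2
  funext w
  rcases w with ⟨i | h, hw⟩ <;> rfl

end MonotoneCircuit

/-!
The circuit is built at random, layer by layer, with AND and OR gates alternating. Let `u x` be the
fraction of the gates of a layer that, on the input `x`, have the value `s`, where `s = false` below
an AND layer and `s = true` below an OR layer. A gate of the next layer has the value `!s` exactly
when none of its inputs has the value `s`, so if it is fed by `k` random gates, this happens with
probability `(1 - u x) ^ k`. Choose `k` such that this is about `exp (-w)`. If `u` is at most `b` on
one side of Majority and at least `b * exp ρ` on the other (the bias is `ρ`), then the new densities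
have a ratio of at least `exp ((w + 1) ρ)`, in the opposite order (`exists_fanIn_amplifying`, which
rests on Bernoulli's inequality).

All `n`-bit inputs are treated at once. By Hoeffding's bound and a union bound
(`exists_sample_approximating`), `exp (O(w))` gates suffice for every density to be within
`exp (-4 w)` of its expectation. Since the gates of a layer are shared, the sizes of the layers add
up and do not multiply, and the additive error costs only a factor `w / (w + 1)` in the exponent
(`Separates.exists_addLayer`).

Inputs whose weight is within about `ε √n / 4` of `n / 2` are ignored; they make up a fraction of at
most `ε / 2` of the cube, as every layer of the cube has at most `2 ^ n / √n` points
(`density_middle_layers_le`). For the remaining inputs the variables have a bias `ρ` of at least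
`ε / (4 √n)`. Each of `d - 1` layers multiplies it by `w`, with a cap at `1` before the last of
these layers, so that it ends up at `6 log (1 / ε)` or more for
`w = 24 n ^ (1 / (2 (d - 1))) log (1 / ε) / ε`. The densities then have a ratio of `ε ^ (-6)`, so
that a last gate fed by a random selection errs on a fraction of at most `ε / 2` of the inputs. This
step holds on average over the inputs and not for each of them (`exists_sample_hitting`).

The bound on `d` is needed for `w` to exceed `log n`, so that factors `n` and `d` are absorbed in
`exp (O(w))`. For `ε > 1 / 2` a constant or a single variable suffices.
-/

/-! ### Random sampling -/

open Classical in
/-- The fraction of the elements of a finite type that satisfy `p`. -/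
noncomputable def density {I : Type*} [Fintype I] (p : I → Prop) : ℝ :=
  ((Finset.univ.filter p).card : ℝ) / Fintype.card I

theorem density_eq {I : Type*} [Fintype I] (p : I → Prop) [DecidablePred p] :
    density p = ((Finset.univ.filter p).card : ℝ) / Fintype.card I := by
  unfold density
  congr!

theorem density_nonneg {I : Type*} [Fintype I] (p : I → Prop) : 0 ≤ density p :=
  div_nonneg (Nat.cast_nonneg _) (Nat.cast_nonneg _)

theorem density_le_one {I : Type*} [Fintype I] (p : I → Prop) : density p ≤ 1 :=
  div_le_one_of_le₀ (by exact_mod_cast Finset.card_le_univ _) (Nat.cast_nonneg _)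

theorem density_mono {I : Type*} [Fintype I] {p q : I → Prop} (h : ∀ i, p i → q i) :
    density p ≤ density q := by
  classical
  rw [density_eq, density_eq]
  gcongr with i
  exact h i

theorem density_or_le {I : Type*} [Fintype I] (p q : I → Prop) :
    density (fun i => p i ∨ q i) ≤ density p + density q := by
  classical
  rw [density_eq, density_eq, density_eq, ← add_div]
  gcongr
  rw [Finset.filter_or]
  exact_mod_cast Finset.card_union_le _ _

theorem density_not {I : Type*} [Fintype I] [Nonempty I] (p : I → Prop) :
    density (fun i => ¬ p i) = 1 - density p := by
  classical
  have hI : (0 : ℝ) < Fintype.card I := by exact_mod_cast Fintype.card_pos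
  have h : (Fintype.card I : ℝ) =
      (Finset.univ.filter p).card + (Finset.univ.filter fun i => ¬ p i).card := by
    exact_mod_cast (Finset.card_filter_add_card_filter_not p).symm
  rw [density_eq, density_eq, one_sub_div hI.ne']
  congr 1
  linarith

theorem density_mul_card {I : Type*} [Fintype I] [Nonempty I] (p : I → Prop) [DecidablePred p] :
    density p * Fintype.card I = ∑ i, if p i then (1 : ℝ) else 0 := by
  have hI : (Fintype.card I : ℝ) ≠ 0 := by exact_mod_cast Fintype.card_ne_zero
  rw [Finset.sum_boole, density_eq, div_mul_cancel₀ _ hI]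

theorem density_comp_equiv {I : Type*} [Fintype I] [Nonempty I] (p : I → Prop) (e : I ≃ I) :
    density (fun i => p (e i)) = density p := by
  classical
  have hI : (Fintype.card I : ℝ) ≠ 0 := by exact_mod_cast Fintype.card_ne_zero
  apply mul_right_cancel₀ hI
  rw [density_mul_card, density_mul_card]
  exact Equiv.sum_comp e fun i => if p i then (1 : ℝ) else 0

/-- The moment generating function of a sum of `m` independent copies of a centred variable with
values in `[-1, 1]`, multiplied by the number of samples. -/
theorem sum_exp_mul_sum_le {Ω : Type*} [Fintype Ω] (y : Ω → ℝ) (hy : ∑ ω, y ω = 0)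
    (hy1 : ∀ ω, |y ω| ≤ 1) (t : ℝ) (ht : |t| ≤ 1) (m : ℕ) :
    ∑ σ : Fin m → Ω, Real.exp (t * ∑ j, y (σ j)) ≤
      (Fintype.card (Fin m → Ω) : ℝ) * Real.exp (t ^ 2 * m) := by
  have h1 : ∀ σ : Fin m → Ω,
      Real.exp (t * ∑ j, y (σ j)) = ∏ j, Real.exp (t * y (σ j)) := by
    intro σ
    rw [Finset.mul_sum, Real.exp_sum]
  have h2 : ∑ ω, Real.exp (t * y ω) ≤ Fintype.card Ω * Real.exp (t ^ 2) := by
    have h3 : ∀ ω, Real.exp (t * y ω) ≤ 1 + t * y ω + t ^ 2 := by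
      intro ω
      have h4 : |t * y ω| ≤ 1 := by
        rw [abs_mul]
        exact mul_le_one₀ ht (abs_nonneg _) (hy1 ω)
      have h5 := (abs_le.1 (Real.abs_exp_sub_one_sub_id_le h4)).2
      have h6 : (t * y ω) ^ 2 ≤ t ^ 2 := by
        rw [mul_pow]
        have : y ω ^ 2 ≤ 1 := (sq_le_one_iff_abs_le_one _).2 (hy1 ω)
        nlinarith [sq_nonneg t]
      linarith
    calc ∑ ω, Real.exp (t * y ω) ≤ ∑ ω, (1 + t * y ω + t ^ 2) :=
          Finset.sum_le_sum fun ω _ => h3 ω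
      _ = Fintype.card Ω * (t ^ 2 + 1) := by
          rw [Finset.sum_add_distrib, Finset.sum_add_distrib, ← Finset.mul_sum, hy]
          simp
          ring
      _ ≤ _ := by
          gcongr
          exact Real.add_one_le_exp _
  calc ∑ σ : Fin m → Ω, Real.exp (t * ∑ j, y (σ j))
      = (∑ ω, Real.exp (t * y ω)) ^ m := by
        rw [Fintype.sum_pow]
        exact Finset.sum_congr rfl fun σ _ => h1 σ
    _ ≤ (Fintype.card Ω * Real.exp (t ^ 2)) ^ m := by
        gcongr
    _ = _ := by
        rw [mul_pow, ← Real.exp_nat_mul]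
        simp [mul_comm]

/-- One sample of size `O(log |X| / τ²)` estimates the densities of all the sets `G x` at the same
time, each with additive error at most `τ`: a Chernoff bound followed by a union bound over `X`. -/
theorem exists_sample_approximating {Ω X : Type*} [Fintype Ω] [Nonempty Ω] [Fintype X]
    [Nonempty X] (G : X → Ω → Prop) {τ : ℝ} (hτ : 0 < τ) (hτ1 : τ ≤ 1) (m : ℕ)
    (hm0 : 0 < m) (hm : 4 * Real.log (2 * Fintype.card X) ≤ m * τ ^ 2) :
    ∃ σ : Fin m → Ω, ∀ x, |density (fun j => G x (σ j)) - density (G x)| ≤ τ := by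
  classical
  have : Nonempty (Fin m) := ⟨⟨0, hm0⟩⟩
  set y : X → Ω → ℝ := fun x ω => (if G x ω then 1 else 0) - density (G x) with hyd
  have hy : ∀ x, ∑ ω, y x ω = 0 := by
    intro x
    simp only [hyd, Finset.sum_sub_distrib, ← density_mul_card, Finset.sum_const, nsmul_eq_mul]
    rw [Finset.card_univ]
    ring
  have hy1 : ∀ x ω, |y x ω| ≤ 1 := by
    intro x ω
    have := density_nonneg (G x)
    have := density_le_one (G x)
    simp only [hyd, abs_le]
    split_ifs <;> constructor <;> linarith
  have hS : ∀ x (σ : Fin m → Ω), ∑ j, y x (σ j) =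
      m * (density (fun j => G x (σ j)) - density (G x)) := by
    intro x σ
    have h := density_mul_card fun j => G x (σ j)
    rw [Fintype.card_fin] at h
    simp only [hyd, Finset.sum_sub_distrib, ← h, Finset.sum_const, nsmul_eq_mul,
      Finset.card_univ, Fintype.card_fin]
    ring
  have htau : |τ / 2| ≤ 1 := by rw [abs_of_pos (by positivity)]; linarith
  have htau' : |-(τ / 2)| ≤ 1 := by rwa [abs_neg]
  obtain ⟨σ, -, hσ⟩ : ∃ σ ∈ (Finset.univ : Finset (Fin m → Ω)),
      ∑ x, (Real.exp (τ / 2 * ∑ j, y x (σ j)) + Real.exp (-(τ / 2) * ∑ j, y x (σ j))) ≤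
        2 * Fintype.card X * Real.exp ((τ / 2) ^ 2 * m) := by
    apply Finset.exists_le_of_sum_le Finset.univ_nonempty
    rw [Finset.sum_comm, Finset.sum_const, nsmul_eq_mul, Finset.card_univ]
    calc _ ≤ ∑ x : X, 2 * ((Fintype.card (Fin m → Ω) : ℝ) * Real.exp ((τ / 2) ^ 2 * m)) := by
          apply Finset.sum_le_sum
          intro x _
          rw [Finset.sum_add_distrib]
          have h1 := sum_exp_mul_sum_le (y x) (hy x) (hy1 x) _ htau m
          have h2 := sum_exp_mul_sum_le (y x) (hy x) (hy1 x) _ htau' m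
          rw [neg_sq] at h2
          linarith
      _ = _ := by
          rw [Finset.sum_const, nsmul_eq_mul, Finset.card_univ]
          ring
  refine ⟨σ, fun x => ?_⟩
  set S := ∑ j, y x (σ j) with hSd
  have h1 := (Finset.single_le_sum (f := fun x => Real.exp (τ / 2 * ∑ j, y x (σ j)) +
    Real.exp (-(τ / 2) * ∑ j, y x (σ j))) (fun x _ => by positivity) (Finset.mem_univ x)).trans hσ
  simp only [← hSd] at h1
  have h2 : Real.exp (τ / 2 * |S|) ≤ 2 * Fintype.card X * Real.exp ((τ / 2) ^ 2 * m) := by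
    rcases abs_cases S with ⟨h, _⟩ | ⟨h, _⟩ <;> rw [h]
    · linarith [Real.exp_pos (-(τ / 2) * S)]
    · rw [mul_neg, ← neg_mul]
      linarith [Real.exp_pos (τ / 2 * S)]
  have h3 : τ / 2 * |S| ≤ Real.log (2 * Fintype.card X) + (τ / 2) ^ 2 * m := by
    rw [← Real.log_exp ((τ / 2) ^ 2 * m), ← Real.log_mul (by positivity) (by positivity)]
    exact (Real.le_log_iff_exp_le (by positivity)).2 h2
  have h4 : τ / 2 * |S| ≤ τ / 2 * (m * τ) := by nlinarith
  have h5 : |S| ≤ m * τ := le_of_mul_le_mul_left h4 (by positivity)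
  have hm0' : (0 : ℝ) < m := by exact_mod_cast hm0
  rw [hSd, hS, abs_mul, abs_of_pos hm0'] at h5
  exact le_of_mul_le_mul_left h5 hm0'

theorem density_forall {I : Type*} [Fintype I] [Nonempty I] (e : I → Prop) (k : ℕ) :
    density (fun ω : Fin k → I => ∀ l, e (ω l)) = density e ^ k := by
  classical
  have : (Finset.univ.filter fun ω : Fin k → I => ∀ l, e (ω l)) =
      Fintype.piFinset fun _ => Finset.univ.filter e := by
    ext ω
    simp [Fintype.mem_piFinset]
  rw [density_eq, density_eq, this, Fintype.card_piFinset, div_pow]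
  simp

theorem density_forall_not {I : Type*} [Fintype I] [Nonempty I] (e : I → Prop) (k : ℕ) :
    density (fun ω : Fin k → I => ∀ l, ¬ e (ω l)) = (1 - density e) ^ k := by
  rw [density_forall fun i => ¬ e i, density_not]

/-- Some sample of `M` members of a family hits almost every `x` in `H`, where the members true at
`x` have density at least `a`, and misses almost every `x` in `L`, where they have density at most
`b`. Unlike `exists_sample_approximating` this holds on average over `x`, so `b` may be far larger
than `1 / |X|`. -/
theorem exists_sample_hitting {I X : Type*} [Fintype I] [Nonempty I] [Fintype X] [Nonempty X]
    (e : X → I → Prop) (H L : X → Prop) {a b : ℝ} (M : ℕ) (ha1 : a ≤ 1) (hb0 : 0 ≤ b)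
    (hH : ∀ x, H x → a ≤ density (e x)) (hL : ∀ x, L x → density (e x) ≤ b) :
    ∃ σ : Fin M → I,
      density (fun x => H x ∧ ∀ j, ¬ e x (σ j)) + density (fun x => L x ∧ ∃ j, e x (σ j)) ≤
        (1 - a) ^ M + M * b := by
  classical
  have hH' : ∀ x, density (fun σ : Fin M → I => H x ∧ ∀ j, ¬ e x (σ j)) ≤ (1 - a) ^ M := by
    intro x
    by_cases hx : H x
    · simp only [hx, true_and]
      rw [density_forall_not (e x)]
      have h1 := density_le_one (e x)
      have h2 := hH x hx
      gcongr
    · have : 0 ≤ 1 - a := by linarith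
      simp only [hx, false_and, density, Finset.filter_false, Finset.card_empty, Nat.cast_zero,
        zero_div]
      positivity
  have hL' : ∀ x, density (fun σ : Fin M → I => L x ∧ ∃ j, e x (σ j)) ≤ M * b := by
    intro x
    by_cases hx : L x
    · simp only [hx, true_and]
      have h1 := density_not fun σ : Fin M → I => ∃ j, e x (σ j)
      simp only [not_exists] at h1
      rw [density_forall_not (e x)] at h1
      have h2 := hL x hx
      have h3 := one_add_mul_le_pow (a := -density (e x)) (by linarith [density_le_one (e x)]) M
      rw [← sub_eq_add_neg] at h3
      have h4 : (M : ℝ) * density (e x) ≤ M * b := by gcongr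
      linarith
    · simp only [hx, false_and, density, Finset.filter_false, Finset.card_empty, Nat.cast_zero,
        zero_div]
      positivity
  have hX : (0 : ℝ) < Fintype.card X := by exact_mod_cast Fintype.card_pos
  obtain ⟨σ, -, hσ⟩ : ∃ σ ∈ (Finset.univ : Finset (Fin M → I)),
      ∑ x, ((if H x ∧ ∀ j, ¬ e x (σ j) then (1 : ℝ) else 0) +
        (if L x ∧ ∃ j, e x (σ j) then (1 : ℝ) else 0)) ≤
      Fintype.card X * ((1 - a) ^ M + M * b) := by
    apply Finset.exists_le_of_sum_le Finset.univ_nonempty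
    rw [Finset.sum_comm, Finset.sum_const, nsmul_eq_mul, Finset.card_univ]
    calc _ ≤ ∑ x : X, ((1 - a) ^ M + M * b) * (Fintype.card (Fin M → I) : ℝ) := by
          apply Finset.sum_le_sum
          intro x _
          rw [Finset.sum_add_distrib, ← density_mul_card fun σ : Fin M → I => _,
            ← density_mul_card fun σ : Fin M → I => _, ← add_mul]
          exact mul_le_mul_of_nonneg_right (add_le_add (hH' x) (hL' x)) (Nat.cast_nonneg _)
      _ = _ := by
          rw [Finset.sum_const, nsmul_eq_mul, Finset.card_univ]
          ring
  refine ⟨σ, ?_⟩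
  rw [Finset.sum_add_distrib, ← density_mul_card, ← density_mul_card, ← add_mul, mul_comm] at hσ
  exact le_of_mul_le_mul_left hσ hX

/-! ### Adding a layer of gates to a circuit -/

namespace MonotoneCircuit

variable {n : ℕ}

/-- The gate type for which a gate has value `s` exactly when all its inputs have value `s`. -/
def kindOf : Bool → GateKind
  | true => GateKind.and
  | false => GateKind.or

theorem evalGate_eq_iff (C : MonotoneCircuit n) (x : Fin n → Bool) (g : C.Gate) (s : Bool)
    (hg : C.kind g = kindOf s) :
    C.evalGate x g = s ↔ ∀ w ∈ C.inputs g, C.evalNode x w = s := by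
  cases s
  · rw [← not_iff_not, Bool.not_eq_false, C.evalGate_or x g hg]
    push Not
    simp only [ne_eq, Bool.not_eq_false]
  · exact C.evalGate_and x g hg

/-- The circuit without gates whose output is the variable `i`. -/
def ofVar (i : Fin n) : MonotoneCircuit n where
  Gate := Empty
  fintypeGate := inferInstance
  kind := Empty.elim
  inputs := fun g => g.elim
  acyclic := ⟨fun g => g.elim⟩
  output := Sum.inl i

/-- The node of the extended circuit that corresponds to a node of the original one. -/
def liftNode {G : Type} (J : Type) : Fin n ⊕ G ↪ Fin n ⊕ (G ⊕ J) :=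
  ⟨Sum.map id Sum.inl, Function.Injective.sumMap Function.injective_id Sum.inl_injective⟩

theorem inr_inl_mem_map_liftNode {G J : Type} {T : Finset (Fin n ⊕ G)} {h : G} :
    Sum.inr (Sum.inl h) ∈ T.map (liftNode J) ↔ Sum.inr h ∈ T := by
  exact Finset.mem_map' (liftNode J) (a := Sum.inr h)

theorem inr_inr_notMem_map_liftNode {G J : Type} {T : Finset (Fin n ⊕ G)} {j : J} :
    Sum.inr (Sum.inr j) ∉ T.map (liftNode J) := by
  rw [Finset.mem_map]
  rintro ⟨i | g, -, h⟩ <;> simp [liftNode] at h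

/-- The circuit `C` with additional gates indexed by `J`, all of the same kind, that are fed by
nodes of `C`. -/
def addLayer (C : MonotoneCircuit n) (J : Type) [Fintype J] (k : GateKind)
    (S : J → Finset (Fin n ⊕ C.Gate)) (out : Fin n ⊕ (C.Gate ⊕ J)) : MonotoneCircuit n where
  Gate := C.Gate ⊕ J
  fintypeGate := inferInstance
  kind := Sum.elim C.kind fun _ => k
  inputs := Sum.elim (fun g => (C.inputs g).map (liftNode J)) fun j => (S j).map (liftNode J)
  acyclic := by
    have hold : ∀ g : C.Gate, Acc (fun h g : C.Gate ⊕ J => Sum.inr h ∈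
        Sum.elim (fun g => (C.inputs g).map (liftNode J)) (fun j => (S j).map (liftNode J)) g)
        (Sum.inl g) := by
      intro g
      induction g using C.acyclic.induction with
      | h g ih =>
        refine ⟨_, ?_⟩
        rintro (h | h) hh
        · refine ih h ?_
          exact inr_inl_mem_map_liftNode.1 hh
        · exact (inr_inr_notMem_map_liftNode hh).elim
    refine ⟨?_⟩
    rintro (g | j)
    · exact hold g
    · refine ⟨_, ?_⟩
      rintro (h | h) hh
      · exact hold h
      · exact (inr_inr_notMem_map_liftNode hh).elim
  output := out

variable (C : MonotoneCircuit n) (J : Type) [Fintype J] (k : GateKind)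
  (S : J → Finset (Fin n ⊕ C.Gate)) (out : Fin n ⊕ (C.Gate ⊕ J))

theorem addLayer_evalGate_inl (x : Fin n → Bool) (g : C.Gate) :
    (C.addLayer J k S out).evalGate x (Sum.inl g) = C.evalGate x g := by
  induction g using C.acyclic.induction with
  | h g ih =>
    have hnode : ∀ w ∈ C.inputs g,
        (C.addLayer J k S out).evalNode x (liftNode J w) = C.evalNode x w := by
      rintro (i | h) hw
      · rfl
      · exact ih h hw
    obtain ⟨s, hs⟩ : ∃ s, C.kind g = kindOf s := by
      cases h : C.kind g
      · exact ⟨true, rfl⟩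
      · exact ⟨false, rfl⟩
    have h1 := C.evalGate_eq_iff x g s hs
    have h2 := (C.addLayer J k S out).evalGate_eq_iff x (Sum.inl g) s hs
    have h3 : (C.addLayer J k S out).evalGate x (Sum.inl g) = s ↔ C.evalGate x g = s := by
      rw [h1, h2]
      change (∀ w ∈ (C.inputs g).map (liftNode J), _) ↔ _
      simp only [Finset.forall_mem_map]
      exact forall₂_congr fun w hw => by rw [hnode w hw]
    revert h3
    cases s <;> cases (C.addLayer J k S out).evalGate x (Sum.inl g) <;>
      cases C.evalGate x g <;> simp

theorem addLayer_evalNode_liftNode (x : Fin n → Bool) (w : Fin n ⊕ C.Gate) :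
    (C.addLayer J k S out).evalNode x (liftNode J w) = C.evalNode x w := by
  rcases w with i | g
  · rfl
  · exact C.addLayer_evalGate_inl J k S out x g

theorem addLayer_evalNode_inr (s : Bool) (x : Fin n → Bool) (j : J) :
    (C.addLayer J (kindOf s) S out).evalNode x (Sum.inr (Sum.inr j)) = s ↔
      ∀ w ∈ S j, C.evalNode x w = s := by
  refine ((C.addLayer J (kindOf s) S out).evalGate_eq_iff x (Sum.inr j) s rfl).trans ?_
  change (∀ w ∈ (S j).map (liftNode J), _) ↔ _
  simp only [Finset.forall_mem_map]
  exact forall₂_congr fun w _ => by rw [addLayer_evalNode_liftNode]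

theorem addLayer_gateDepth_inl (g : C.Gate) :
    (C.addLayer J k S out).gateDepth (Sum.inl g) = C.gateDepth g := by
  induction g using C.acyclic.induction with
  | h g ih =>
    refine ((C.addLayer J k S out).gateDepth_eq (Sum.inl g)).trans ?_
    rw [C.gateDepth_eq g]
    refine (congrArg (· + 1) (Finset.sup_map (C.inputs g) (liftNode J) _)).trans ?_
    congr 1
    refine Finset.sup_congr rfl ?_
    rintro (i | h) hw
    · rfl
    · exact ih h hw

theorem nodeDepth_le_depth (w : Fin n ⊕ C.Gate) : C.nodeDepth w ≤ C.depth := by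
  rcases w with i | g
  · exact Nat.zero_le _
  · exact Finset.le_sup (f := C.gateDepth) (Finset.mem_univ g)

theorem addLayer_depth_le : (C.addLayer J k S out).depth ≤ C.depth + 1 := by
  refine Finset.sup_le ?_
  rintro (g | j) -
  · rw [addLayer_gateDepth_inl]
    exact (C.nodeDepth_le_depth (Sum.inr g)).trans (Nat.le_succ _)
  · refine ((C.addLayer J k S out).gateDepth_eq (Sum.inr j)).trans_le ?_
    refine (congrArg (· + 1) (Finset.sup_map (S j) (liftNode J) _)).trans_le ?_
    refine Nat.succ_le_succ ?_
    refine Finset.sup_le ?_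
    rintro (i | g) -
    · exact Nat.zero_le _
    · refine le_of_eq_of_le (C.addLayer_gateDepth_inl J k S out g) ?_
      exact C.nodeDepth_le_depth (Sum.inr g)

theorem addLayer_size : (C.addLayer J k S out).size = C.size + Fintype.card J := by
  change Fintype.card (C.Gate ⊕ J) = _
  rw [Fintype.card_sum]
  rfl

theorem ofVar_depth (i : Fin n) : (ofVar i).depth = 0 := by
  refine Nat.le_zero.1 (Finset.sup_le ?_)
  exact fun g => Empty.elim g

theorem ofVar_size (i : Fin n) : (ofVar i).size = 0 := rfl

end MonotoneCircuit

/-! ### Central binomial coefficients -/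

theorem three_mul_add_one_mul_centralBinom_sq_le (m : ℕ) :
    (3 * m + 1) * m.centralBinom ^ 2 ≤ 16 ^ m := by
  induction m with
  | zero => simp
  | succ m ih =>
    have h := Nat.succ_mul_centralBinom_succ m
    have h2 : (m + 1) ^ 2 * ((3 * (m + 1) + 1) * (m + 1).centralBinom ^ 2) ≤
        (m + 1) ^ 2 * 16 ^ (m + 1) := by
      calc (m + 1) ^ 2 * ((3 * (m + 1) + 1) * (m + 1).centralBinom ^ 2)
          = (3 * (m + 1) + 1) * ((m + 1) * (m + 1).centralBinom) ^ 2 := by ring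
        _ = 4 * ((3 * m + 4) * (2 * m + 1) ^ 2) * m.centralBinom ^ 2 := by
            rw [h]; ring
        _ ≤ 4 * (4 * (m + 1) ^ 2 * (3 * m + 1)) * m.centralBinom ^ 2 := by
            gcongr 4 * ?_ * _
            nlinarith
        _ = 16 * (m + 1) ^ 2 * ((3 * m + 1) * m.centralBinom ^ 2) := by ring
        _ ≤ 16 * (m + 1) ^ 2 * 16 ^ m := by gcongr
        _ = _ := by ring
    exact Nat.le_of_mul_le_mul_left h2 (by positivity)

theorem mul_choose_half_sq_le (n : ℕ) : n * n.choose (n / 2) ^ 2 ≤ 4 ^ n := by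
  rcases Nat.even_or_odd' n with ⟨m, rfl | rfl⟩
  · rw [Nat.mul_div_cancel_left m two_pos, ← Nat.centralBinom_eq_two_mul_choose, pow_mul]
    refine le_trans ?_ (three_mul_add_one_mul_centralBinom_sq_le m)
    gcongr
    omega
  · have h1 : (2 * m + 1) / 2 = m := by omega
    have h2 : (m + 1).centralBinom = 2 * (2 * m + 1).choose m := by
      rw [Nat.centralBinom_eq_two_mul_choose, show 2 * (m + 1) = 2 * m + 1 + 1 by ring,
        Nat.choose_succ_succ, Nat.choose_symm_half]
      ring
    have h3 := three_mul_add_one_mul_centralBinom_sq_le (m + 1)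
    rw [h2] at h3
    rw [h1]
    have h4 : (4 : ℕ) ^ (2 * m + 1) * 4 = 16 ^ (m + 1) := by
      rw [show (16 : ℕ) = 4 ^ 2 by norm_num, ← pow_mul]
      ring
    have h5 : (2 * m + 1) * (2 * m + 1).choose m ^ 2 ≤
        (3 * (m + 1) + 1) * (2 * m + 1).choose m ^ 2 := by
      gcongr <;> omega
    nlinarith

theorem choose_mul_sqrt_le (n j : ℕ) : (n.choose j : ℝ) * √n ≤ 2 ^ n := by
  have h : (n : ℝ) * (n.choose (n / 2) : ℝ) ^ 2 ≤ 4 ^ n := by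
    exact_mod_cast mul_choose_half_sq_le n
  have h1 : (n.choose j : ℝ) ≤ n.choose (n / 2) := by exact_mod_cast Nat.choose_le_middle j n
  refine le_trans (mul_le_mul_of_nonneg_right h1 (Real.sqrt_nonneg _)) ?_
  refine abs_le_of_sq_le_sq' ?_ (by positivity) |>.2
  rw [mul_pow, Real.sq_sqrt (Nat.cast_nonneg _), ← pow_mul, mul_comm n 2, pow_mul]
  norm_num
  linarith

/-- The Hamming weight of a point of the cube. -/
def weight {n : ℕ} (x : Fin n → Bool) : ℕ := (Finset.univ.filter fun i => x i = true).card

theorem card_weight_eq (n j : ℕ) :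
    (Finset.univ.filter fun x : Fin n → Bool => weight x = j).card = n.choose j := by
  have h : ((Finset.univ : Finset (Fin n)).powersetCard j).card = n.choose j := by simp
  unfold weight
  rw [← h]
  refine Finset.card_bij' (fun x _ => Finset.univ.filter fun i => x i = true)
    (fun s _ i => decide (i ∈ s)) ?_ ?_ ?_ ?_
  · intro x hx
    rw [Finset.mem_powersetCard_univ]
    exact (Finset.mem_filter.1 hx).2
  · intro s hs
    rw [Finset.mem_powersetCard_univ] at hs
    rw [Finset.mem_filter]
    simpa using hs
  · intro x _
    ext i
    simp
  · intro s _
    ext i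
    simp

/-- Each of the `2 r` middle layers of the cube has at most `2 ^ n / √n` points. -/
theorem density_middle_layers_le (n r : ℕ) :
    density (fun x : Fin n → Bool => n / 2 < weight x + r ∧ weight x < n / 2 + 1 + r) * √n ≤
      2 * r := by
  have h1 : (Finset.univ.filter fun x : Fin n → Bool =>
      n / 2 < weight x + r ∧ weight x < n / 2 + 1 + r) ⊆
      (Finset.Ico (n / 2 + 1 - r) (n / 2 + 1 + r)).biUnion fun j =>
        Finset.univ.filter fun x : Fin n → Bool => weight x = j := by
    intro x hx
    simp only [Finset.mem_filter, Finset.mem_univ, true_and] at hx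
    simp only [Finset.mem_biUnion, Finset.mem_Ico, Finset.mem_filter, Finset.mem_univ, true_and]
    exact ⟨weight x, by omega, rfl⟩
  have h2 := (Finset.card_le_card h1).trans Finset.card_biUnion_le
  simp only [card_weight_eq] at h2
  have h3 : (Fintype.card (Fin n → Bool) : ℝ) = 2 ^ n := by simp
  rw [density_eq, h3, div_mul_eq_mul_div, div_le_iff₀ (by positivity)]
  calc _ ≤ ((∑ j ∈ Finset.Ico (n / 2 + 1 - r) (n / 2 + 1 + r), n.choose j : ℕ) : ℝ) * √n := by
        gcongr
    _ = ∑ j ∈ Finset.Ico (n / 2 + 1 - r) (n / 2 + 1 + r), (n.choose j : ℝ) * √n := by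
        push_cast
        rw [Finset.sum_mul]
    _ ≤ ∑ j ∈ Finset.Ico (n / 2 + 1 - r) (n / 2 + 1 + r), (2 : ℝ) ^ n :=
        Finset.sum_le_sum fun j _ => choose_mul_sqrt_le n j
    _ ≤ _ := by
        rw [Finset.sum_const, nsmul_eq_mul, Nat.card_Ico]
        gcongr
        have : n / 2 + 1 + r - (n / 2 + 1 - r) ≤ 2 * r := by omega
        exact_mod_cast this

/-! ### Amplification by alternating layers -/

/-- The numerical core of one layer. Let `k` be chosen so that `(1 - b) ^ k ≈ exp (-w)`. The map
`u ↦ (1 - u) ^ k` sends two densities with ratio `exp ρ` to two densities with ratio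
`exp ((w + 1) ρ)`, in the opposite order; part of this gain pays for an additive error `τ`. -/
theorem exists_fanIn_amplifying {w b ρ ρ' τ : ℝ} (hb0 : 0 < b) (hb : b ≤ 1 / 2) (hw : 0 ≤ w)
    (hρ0 : 0 < ρ) (hρ1 : ρ ≤ 1) (hρ'0 : 0 ≤ ρ') (hρ' : ρ' ≤ w * ρ) (hτ0 : 0 < τ)
    (hτ : 4 * τ * Real.exp (2 * w + 2) ≤ ρ) :
    ∃ (k : ℕ) (b' : ℝ), 0 < b' ∧ b' ≤ 1 / 2 ∧ b' * Real.exp ρ' ≤ 1 ∧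
      (∀ u, u ≤ b → b' * Real.exp ρ' ≤ (1 - u) ^ k - τ) ∧
      ∀ u, b * Real.exp ρ ≤ u → u ≤ 1 → (1 - u) ^ k + τ ≤ b' := by
  have hb1 : 0 < 1 - b := by linarith
  set l := -Real.log (1 - b) with hl
  have hexp : Real.exp (-l) = 1 - b := by rw [hl, neg_neg, Real.exp_log hb1]
  have hlb : b ≤ l := by
    have := Real.log_le_sub_one_of_pos hb1
    linarith
  have hl0 : 0 < l := hb0.trans_le hlb
  have hl1 : l ≤ 1 := by
    have h1 : Real.log (1 / 2) ≤ Real.log (1 - b) :=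
      Real.log_le_log (by norm_num) (by linarith)
    have h2 := Real.one_sub_inv_le_log_of_pos (x := 1 / 2) (by norm_num)
    norm_num at h2
    norm_num at h1
    linarith
  set k := ⌈(w + 1) / l⌉₊ with hk
  have hk1 : w + 1 ≤ l * k := by
    have := Nat.le_ceil ((w + 1) / l)
    rw [div_le_iff₀ hl0] at this
    linarith
  have hk2 : l * k ≤ w + 2 := by
    have := (Nat.ceil_lt_add_one (a := (w + 1) / l) (by positivity)).le
    calc l * k ≤ l * ((w + 1) / l + 1) := by gcongr
      _ = w + 1 + l := by field_simp
      _ ≤ _ := by linarith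
  set A := Real.exp (-(l * k)) with hA
  have hA0 : 0 < A := Real.exp_pos _
  have hAk : A = (1 - b) ^ k := by
    rw [hA, ← hexp, ← Real.exp_nat_mul]
    congr 1
    ring
  have hAhalf : A ≤ 1 / 2 := by
    have h1 : A ≤ Real.exp (-1) := Real.exp_le_exp.2 (by linarith)
    have h2 := Real.exp_neg_one_lt_d9
    norm_num at h2 ⊢
    linarith
  have hτA : 4 * τ * Real.exp w ≤ ρ * A := by
    have h1 : 1 ≤ Real.exp (w + 2) * A := by
      rw [hA, ← Real.exp_add]
      exact Real.one_le_exp (by linarith)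
    have h2 : Real.exp (2 * w + 2) = Real.exp w * Real.exp (w + 2) := by
      rw [← Real.exp_add]
      congr 1
      ring
    calc 4 * τ * Real.exp w = 4 * τ * Real.exp w * 1 := (mul_one _).symm
      _ ≤ 4 * τ * Real.exp w * (Real.exp (w + 2) * A) := by gcongr
      _ = 4 * τ * Real.exp (2 * w + 2) * A := by rw [h2]; ring
      _ ≤ _ := by gcongr
  have hτA' : 4 * τ ≤ A := by
    have h1 : 1 ≤ Real.exp w := Real.one_le_exp hw
    nlinarith
  have hcancel : (A - τ) * Real.exp (-ρ') * Real.exp ρ' = A - τ := by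
    rw [mul_assoc, ← Real.exp_add, neg_add_cancel, Real.exp_zero, mul_one]
  refine ⟨k, (A - τ) * Real.exp (-ρ'), ?_, ?_, ?_, ?_, ?_⟩
  · exact mul_pos (by linarith) (Real.exp_pos _)
  · have h1 : Real.exp (-ρ') ≤ 1 := Real.exp_le_one_iff.2 (by linarith)
    have h2 : (A - τ) * Real.exp (-ρ') ≤ (A - τ) * 1 := by
      gcongr
      linarith
    linarith
  · rw [hcancel]
    linarith
  · intro u hu
    rw [hcancel, hAk]
    gcongr
  · intro u hu hu1
    have h1 : 1 - u ≤ Real.exp (-(l * Real.exp ρ)) := by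
      have h := one_add_mul_self_le_rpow_one_add (s := -b) (by linarith)
        (Real.one_le_exp hρ0.le)
      rw [← sub_eq_add_neg, ← hexp, ← Real.exp_mul] at h
      rw [← neg_mul]
      linarith
    have h2 : (1 - u) ^ k ≤ A * Real.exp (-((w + 1) * ρ)) := by
      calc (1 - u) ^ k ≤ Real.exp (-(l * Real.exp ρ)) ^ k := by
            gcongr
        _ = Real.exp (-(l * k) + -(l * k * (Real.exp ρ - 1))) := by
            rw [← Real.exp_nat_mul]
            congr 1
            ring
        _ ≤ Real.exp (-(l * k) + -((w + 1) * ρ)) := by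
            have h3 : ρ ≤ Real.exp ρ - 1 := by linarith [Real.add_one_le_exp ρ]
            gcongr
        _ = _ := by rw [Real.exp_add]
    set E := Real.exp (-(w * ρ)) with hE
    have hE0 : 0 < E := Real.exp_pos _
    have hE1 : E ≤ 1 := Real.exp_le_one_iff.2 (by nlinarith)
    have hEρ' : E ≤ Real.exp (-ρ') := Real.exp_le_exp.2 (by linarith)
    have hEw : 1 ≤ Real.exp w * E := by
      rw [hE, ← Real.exp_add]
      exact Real.one_le_exp (by nlinarith)
    have h4 : Real.exp (-((w + 1) * ρ)) = E * Real.exp (-ρ) := by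
      rw [hE, ← Real.exp_add]
      congr 1
      ring
    have h5 : Real.exp (-ρ) ≤ 1 - ρ / 2 := by
      rw [Real.exp_neg]
      refine inv_le_of_inv_le₀ (by linarith) ?_
      refine le_trans ?_ (Real.add_one_le_exp ρ)
      rw [inv_le_iff_one_le_mul₀ (by linarith)]
      nlinarith
    have h6 : 4 * τ ≤ ρ * A * E := by
      calc 4 * τ = 4 * τ * 1 := (mul_one _).symm
        _ ≤ 4 * τ * (Real.exp w * E) := by gcongr
        _ = 4 * τ * Real.exp w * E := by ring
        _ ≤ _ := by gcongr
    have h7 : A * (E * Real.exp (-ρ)) ≤ A * (E * (1 - ρ / 2)) := by gcongr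
    have h8 : (A - τ) * E ≤ (A - τ) * Real.exp (-ρ') := by
      gcongr
      linarith
    rw [h4] at h2
    nlinarith

/-- The inputs that have to be decided: `side n r true` consists of those whose weight exceeds half
of `n` by a margin of `r`, `side n r false` of those that fall short of it by `r`. -/
def side (n r : ℕ) : Bool → (Fin n → Bool) → Prop
  | true, x => n / 2 + 1 + r ≤ weight x
  | false, x => weight x + r ≤ n / 2

theorem majority_eq_of_side {n r : ℕ} {t : Bool} {x : Fin n → Bool} (h : side n r t x) :
    majority n x = t := by
  cases t
  · have h' : weight x + r ≤ n / 2 := h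
    unfold weight at h'
    simp only [majority, decide_eq_false_iff_not]
    omega
  · have h' : n / 2 + 1 + r ≤ weight x := h
    unfold weight at h'
    simp only [majority, decide_eq_true_eq]
    omega

theorem isApproxMajority_iff (ε : ℝ) (n : ℕ) (f : (Fin n → Bool) → Bool) :
    IsApproxMajority ε n f ↔ density (fun x => f x ≠ majority n x) ≤ ε := by
  have h : (Fintype.card (Fin n → Bool) : ℝ) = 2 ^ n := by simp
  rw [density_eq, h, IsApproxMajority]

/-- The nodes `out i` of `C` separate the two sides with bias `ρ`: the density of the value `s` is
at most `b` on the side `!s` and at least `b * exp ρ` on the side `s`. -/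
structure Separates {n : ℕ} (r : ℕ) (C : MonotoneCircuit n) {I : Type} [Fintype I]
    (out : I → Fin n ⊕ C.Gate) (s : Bool) (b ρ : ℝ) : Prop where
  low : ∀ x, side n r (!s) x → density (fun i => C.evalNode x (out i) = s) ≤ b
  high : ∀ x, side n r s x → b * Real.exp ρ ≤ density fun i => C.evalNode x (out i) = s

/-- One more layer, of `m` gates, multiplies the bias by `w` and flips the polarity. -/
theorem Separates.exists_addLayer {n r : ℕ} {C : MonotoneCircuit n} {I : Type} [Fintype I]
    [Nonempty I] {out : I → Fin n ⊕ C.Gate} {s : Bool} {w b ρ ρ' τ : ℝ}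
    (h : Separates r C out s b ρ) (hb0 : 0 < b) (hb : b ≤ 1 / 2) (hw : 0 ≤ w)
    (hρ0 : 0 < ρ) (hρ1 : ρ ≤ 1) (hρ'0 : 0 ≤ ρ') (hρ' : ρ' ≤ w * ρ) (hτ0 : 0 < τ)
    (hτ : 4 * τ * Real.exp (2 * w + 2) ≤ ρ) {m : ℕ} (hm : 4 * ((n : ℝ) + 1) ≤ m * τ ^ 2) :
    ∃ (C' : MonotoneCircuit n) (out' : Fin m → Fin n ⊕ C'.Gate) (b' : ℝ),
      C'.depth ≤ C.depth + 1 ∧ C'.size = C.size + m ∧ 0 < b' ∧ b' ≤ 1 / 2 ∧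
      b' * Real.exp ρ' ≤ 1 ∧ Separates r C' out' (!s) b' ρ' := by
  classical
  obtain ⟨k, b', hb'0, hb', hbρ, hlow, hhigh⟩ :=
    exists_fanIn_amplifying hb0 hb hw hρ0 hρ1 hρ'0 hρ' hτ0 hτ
  have hm0 : (0 : ℝ) < m := by
    by_contra hcon
    have h1 : (m : ℝ) ≤ 0 := not_lt.1 hcon
    have h2 : (m : ℝ) * τ ^ 2 ≤ 0 := mul_nonpos_of_nonpos_of_nonneg h1 (by positivity)
    have h3 : (0 : ℝ) ≤ n := Nat.cast_nonneg n
    linarith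
  have hτ1 : τ ≤ 1 := by
    have h1 : 1 ≤ Real.exp (2 * w + 2) := Real.one_le_exp (by linarith)
    nlinarith
  have hlog : 4 * Real.log (2 * Fintype.card (Fin n → Bool)) ≤ m * τ ^ 2 := by
    refine le_trans ?_ hm
    have h1 : (2 * Fintype.card (Fin n → Bool) : ℝ) = 2 ^ (n + 1) := by
      simp [pow_succ, mul_comm]
    rw [h1, Real.log_pow]
    have h2 : Real.log 2 ≤ 1 := by linarith [Real.log_two_lt_d9]
    have h3 : ((n + 1 : ℕ) : ℝ) * Real.log 2 ≤ ((n + 1 : ℕ) : ℝ) * 1 := by gcongr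
    push_cast at h3 ⊢
    linarith
  obtain ⟨σ, hσ⟩ := exists_sample_approximating
    (fun (x : Fin n → Bool) (ω : Fin k → I) => ∀ l, ¬ C.evalNode x (out (ω l)) = s)
    hτ0 hτ1 m (by exact_mod_cast hm0) hlog
  set S : Fin m → Finset (Fin n ⊕ C.Gate) :=
    fun j => Finset.univ.image fun l => out (σ j l) with hS
  set C' := C.addLayer (Fin m) (MonotoneCircuit.kindOf (!s)) S
    (MonotoneCircuit.liftNode _ C.output) with hC'
  set out' : Fin m → Fin n ⊕ C'.Gate := fun j => Sum.inr (Sum.inr j) with hout'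
  have hval : ∀ x j, C'.evalNode x (out' j) = !s ↔ ∀ l, ¬ C.evalNode x (out (σ j l)) = s := by
    intro x j
    refine (C.addLayer_evalNode_inr (Fin m) S _ (!s) x j).trans ?_
    simp only [hS, Finset.mem_image, Finset.mem_univ, true_and, forall_exists_index,
      forall_apply_eq_imp_iff]
    exact forall_congr' fun l => by rw [Bool.eq_not]
  have hdens : ∀ x, |density (fun j => C'.evalNode x (out' j) = !s) -
      (1 - density fun i => C.evalNode x (out i) = s) ^ k| ≤ τ := by
    intro x
    have h1 := hσ x
    rw [density_forall_not (fun i => C.evalNode x (out i) = s) k] at h1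
    simp only [hval]
    exact h1
  refine ⟨C', out', b', C.addLayer_depth_le .., ?_, hb'0, hb', hbρ, ?_, ?_⟩
  · simpa using C.addLayer_size (Fin m) (MonotoneCircuit.kindOf (!s)) S
      (MonotoneCircuit.liftNode _ C.output)
  · intro x hx
    rw [Bool.not_not] at hx
    have h1 := hhigh _ (h.high x hx) (density_le_one _)
    have h2 := (abs_le.1 (hdens x)).2
    linarith
  · intro x hx
    have h1 := hlow _ (h.low x hx)
    have h2 := (abs_le.1 (hdens x)).1
    linarith

/-- The output gate: if the bias is large enough, a suitable gate fed by some of the nodes `out i`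
computes Majority on most inputs. -/
theorem Separates.exists_approxMajority {n r : ℕ} {C : MonotoneCircuit n} {I : Type} [Fintype I]
    [Nonempty I] {out : I → Fin n ⊕ C.Gate} {s : Bool} {b ε : ℝ} (hε0 : 0 < ε)
    (hε : ε ≤ 1 / 2) (h : Separates r C out s b (6 * Real.log (1 / ε))) (hb0 : 0 < b)
    (hb : b * Real.exp (6 * Real.log (1 / ε)) ≤ 1)
    (hr : 4 * (r : ℝ) ≤ ε * √n) (hn : 0 < n) :
    ∃ C' : MonotoneCircuit n, IsApproxMajority ε n C'.eval ∧ C'.depth ≤ C.depth + 1 ∧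
      C'.size = C.size + 1 := by
  classical
  have hexp : Real.exp (6 * Real.log (1 / ε)) = (1 / ε) ^ 6 := by
    rw [show (6 : ℝ) = (6 : ℕ) by norm_num, Real.exp_nat_mul, Real.exp_log (by positivity)]
  set a := b * Real.exp (6 * Real.log (1 / ε)) with ha
  have ha0 : 0 < a := mul_pos hb0 (Real.exp_pos _)
  have hba : b = a * ε ^ 6 := by
    rw [ha, hexp]
    field_simp
  have hlog0 : 0 ≤ Real.log (4 / ε) := Real.log_nonneg (by rw [le_div_iff₀ hε0]; linarith)
  -- `M` gates are enough to be hit on the side `s`, where the density is at least `a`; on the other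
  -- side the density is `b = a ε ^ 6`, so that a union bound over the `M` gates rules out a hit.
  set M := ⌈Real.log (4 / ε) / a⌉₊ with hM
  have hM1 : Real.log (4 / ε) ≤ a * M := by
    have := Nat.le_ceil (Real.log (4 / ε) / a)
    rw [div_le_iff₀ ha0] at this
    linarith
  have hM2 : a * M ≤ Real.log (4 / ε) + a := by
    have := (Nat.ceil_lt_add_one (a := Real.log (4 / ε) / a) (by positivity)).le
    calc a * M ≤ a * (Real.log (4 / ε) / a + 1) := by gcongr
      _ = _ := by field_simp
  have herr1 : (1 - a) ^ M ≤ ε / 4 := by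
    calc (1 - a) ^ M ≤ Real.exp (-a) ^ M := by
          have := Real.add_one_le_exp (-a)
          exact pow_le_pow_left₀ (by linarith) (by linarith) M
      _ = Real.exp (-(a * M)) := by
          rw [← Real.exp_nat_mul]
          congr 1
          ring
      _ ≤ Real.exp (-Real.log (4 / ε)) := Real.exp_le_exp.2 (by linarith)
      _ = ε / 4 := by
          rw [Real.exp_neg, Real.exp_log (by positivity), inv_div]
  have herr2 : M * b ≤ ε / 4 := by
    have h1 := Real.log_le_sub_one_of_pos (x := 4 / ε) (by positivity)
    have h2 : a * M ≤ 4 / ε := by linarith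
    have h4 : ε ^ 4 ≤ (1 / 2) ^ 4 := by gcongr
    calc M * b = a * M * ε ^ 6 := by rw [hba]; ring
      _ ≤ 4 / ε * ε ^ 6 := by gcongr
      _ = 4 * ε * ε ^ 4 := by field_simp
      _ ≤ 4 * ε * (1 / 2) ^ 4 := by gcongr
      _ = _ := by ring
  obtain ⟨σ, hσ⟩ := exists_sample_hitting
    (fun (x : Fin n → Bool) (i : I) => C.evalNode x (out i) = s) (side n r s) (side n r (!s))
    M hb hb0.le h.high h.low
  set S : Unit → Finset (Fin n ⊕ C.Gate) := fun _ => Finset.univ.image fun j => out (σ j) with hS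
  set C' := C.addLayer Unit (MonotoneCircuit.kindOf (!s)) S (Sum.inr (Sum.inr ())) with hC'
  have hval : ∀ x, C'.eval x = !s ↔ ∀ j, ¬ C.evalNode x (out (σ j)) = s := by
    intro x
    refine (C.addLayer_evalNode_inr Unit S _ (!s) x ()).trans ?_
    simp only [hS, Finset.mem_image, Finset.mem_univ, true_and, forall_exists_index,
      forall_apply_eq_imp_iff]
    exact forall_congr' fun l => by rw [Bool.eq_not]
  refine ⟨C', ?_, C.addLayer_depth_le .., ?_⟩
  · have hsub : ∀ x, C'.eval x ≠ majority n x →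
        (n / 2 < weight x + r ∧ weight x < n / 2 + 1 + r) ∨
        ((side n r s x ∧ ∀ j, ¬ C.evalNode x (out (σ j)) = s) ∨
          (side n r (!s) x ∧ ∃ j, C.evalNode x (out (σ j)) = s)) := by
      intro x hx'
      by_cases h1 : side n r s x
      · right; left
        rw [majority_eq_of_side h1] at hx'
        exact ⟨h1, (hval x).1 (Bool.eq_not.2 hx')⟩
      by_cases h2 : side n r (!s) x
      · right; right
        rw [majority_eq_of_side h2, ne_eq, hval x] at hx'
        push Not at hx'
        exact ⟨h2, hx'⟩
      left
      cases s <;> simp only [side, Bool.not_false, Bool.not_true, not_le] at h1 h2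
      · exact ⟨h1, h2⟩
      · exact ⟨h2, h1⟩
    have hmid : density (fun x : Fin n → Bool =>
        n / 2 < weight x + r ∧ weight x < n / 2 + 1 + r) ≤ ε / 2 := by
      have h1 := density_middle_layers_le n r
      have h2 : (0 : ℝ) < √n := Real.sqrt_pos.2 (by exact_mod_cast hn)
      refine le_of_mul_le_mul_right (h1.trans ?_) h2
      linarith
    rw [isApproxMajority_iff]
    refine (density_mono hsub).trans ((density_or_le _ _).trans ?_)
    have hor := density_or_le (fun x => side n r s x ∧ ∀ j, ¬ C.evalNode x (out (σ j)) = s)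
      (fun x => side n r (!s) x ∧ ∃ j, C.evalNode x (out (σ j)) = s)
    linarith
  · simpa using C.addLayer_size Unit (MonotoneCircuit.kindOf (!s)) S (Sum.inr (Sum.inr ()))

/-! ### The construction of the circuit -/

theorem weight_not {n : ℕ} (x : Fin n → Bool) : weight (fun i => !x i) + weight x = n := by
  have h := Finset.card_filter_add_card_filter_not (s := Finset.univ) fun i => x i = true
  simp only [Finset.card_univ, Fintype.card_fin] at h
  simp only [weight, Bool.not_eq_true', Bool.not_eq_true] at h ⊢
  omega

/-- The variables themselves, with respect to the value `false`, have bias at least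
`(2 r + 1) / n`. -/
theorem separates_variables {n r : ℕ} (i₀ : Fin n) (hr : n / 2 + 1 + r < n) :
    ∃ b : ℝ, 0 < b ∧ b ≤ 1 / 2 ∧ Separates r (MonotoneCircuit.ofVar i₀)
      (fun i : Fin n => Sum.inl i) false b ((2 * r + 1) / n) := by
  have hn0 : 0 < n := by omega
  have hn : (0 : ℝ) < n := by exact_mod_cast hn0
  obtain ⟨B, hB⟩ : ∃ B, n = n / 2 + 1 + r + B := ⟨n - (n / 2 + 1 + r), by omega⟩
  have hB0 : (0 : ℝ) < B := by
    have : 0 < B := by omega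
    exact_mod_cast this
  have hBn : 2 * (B : ℝ) ≤ n := by
    have : 2 * B ≤ n := by omega
    exact_mod_cast this
  have hdens : ∀ x : Fin n → Bool, density (fun i : Fin n =>
      (MonotoneCircuit.ofVar i₀).evalNode x (Sum.inl i) = false) =
        (weight fun i => !x i : ℕ) / (n : ℝ) := by
    intro x
    change density (fun i : Fin n => x i = false) = _
    rw [density_eq, Fintype.card_fin]
    simp [weight]
  refine ⟨B / n, by positivity, ?_, ?_, ?_⟩
  · rw [div_le_iff₀ hn]
    linarith
  · intro x hx
    have h1 : n / 2 + 1 + r ≤ weight x := hx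
    have h2 := weight_not x
    rw [hdens]
    gcongr
    omega
  · intro x hx
    have h1 : weight x + r ≤ n / 2 := hx
    have h2 := weight_not x
    rw [hdens]
    set ρ : ℝ := (2 * r + 1) / n with hρ
    have hρ0 : 0 ≤ ρ := by positivity
    have hρ1 : ρ ≤ 1 := by
      rw [hρ, div_le_one hn]
      have : 2 * r + 1 ≤ n := by omega
      exact_mod_cast this
    have hexp : Real.exp ρ ≤ 1 + 2 * ρ := by
      have h3 := (abs_le.1 (Real.abs_exp_sub_one_sub_id_le (abs_le.2 ⟨by linarith, hρ1⟩))).2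
      nlinarith
    have h4 : (B : ℝ) + (2 * r + 1) ≤ (weight fun i => !x i : ℕ) := by
      have : B + (2 * r + 1) ≤ weight fun i => !x i := by omega
      exact_mod_cast this
    have h5 : ρ * n = 2 * r + 1 := by
      rw [hρ]
      field_simp
    rw [div_mul_eq_mul_div, div_le_div_iff_of_pos_right hn]
    calc (B : ℝ) * Real.exp ρ ≤ B * (1 + 2 * ρ) := by gcongr
      _ = B + 2 * B * ρ := by ring
      _ ≤ B + n * ρ := by gcongr
      _ ≤ _ := by linarith

/-- After `i` layers of `m` gates the bias has grown by the factor `w ^ i`, unless it has reached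
the value `1`. -/
theorem exists_separating_circuit {n r m : ℕ} {w τ : ℝ} (hr : n / 2 + 1 + r < n) (hw : 1 ≤ w)
    (hτ0 : 0 < τ) (hτ : 4 * τ * Real.exp (2 * w + 2) ≤ (2 * r + 1) / n)
    (hm : 4 * ((n : ℝ) + 1) ≤ m * τ ^ 2) (i : ℕ) :
    ∃ (C : MonotoneCircuit n) (N : ℕ) (out : Fin N → Fin n ⊕ C.Gate) (s : Bool) (b : ℝ),
      0 < N ∧ C.depth ≤ i ∧ C.size = i * m ∧ 0 < b ∧ b ≤ 1 / 2 ∧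
      Separates r C out s b (min 1 ((2 * r + 1) / n * w ^ i)) := by
  have hn0 : 0 < n := by omega
  have hn : (0 : ℝ) < n := by exact_mod_cast hn0
  set ρ : ℝ := (2 * r + 1) / n with hρ
  have hρ0 : 0 < ρ := by positivity
  have hρ1 : ρ ≤ 1 := by
    rw [hρ, div_le_one hn]
    have : 2 * r + 1 ≤ n := by omega
    exact_mod_cast this
  induction i with
  | zero =>
    obtain ⟨b, hb0, hb, h⟩ := separates_variables ⟨0, hn0⟩ hr
    refine ⟨MonotoneCircuit.ofVar ⟨0, hn0⟩, n, fun i => Sum.inl i, false, b, hn0,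
      (MonotoneCircuit.ofVar_depth _).le, ?_, hb0, hb, ?_⟩
    · rw [MonotoneCircuit.ofVar_size, zero_mul]
    · rw [pow_zero, mul_one, min_eq_right hρ1]
      exact h
  | succ i ih =>
    obtain ⟨C, N, out, s, b, hN, hdepth, hsize, hb0, hb, h⟩ := ih
    have : Nonempty (Fin N) := ⟨⟨0, hN⟩⟩
    have hwi : 1 ≤ w ^ i := one_le_pow₀ hw
    have hle : ρ ≤ min 1 (ρ * w ^ i) := le_min hρ1 (le_mul_of_one_le_right hρ0.le hwi)
    have hgrow : min 1 (ρ * w ^ (i + 1)) ≤ w * min 1 (ρ * w ^ i) := by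
      rw [mul_min_of_nonneg _ _ (by linarith)]
      refine min_le_min (by linarith) (le_of_eq ?_)
      ring
    obtain ⟨C', out', b', hd', hs', hb'0, hb', -, h'⟩ :=
      h.exists_addLayer (ρ' := min 1 (ρ * w ^ (i + 1))) hb0 hb (by linarith)
        (hρ0.trans_le hle) (min_le_left _ _) (le_min zero_le_one (by positivity)) hgrow hτ0
        (hτ.trans hle) hm
    have hm0 : 0 < m := by
      rcases Nat.eq_zero_or_pos m with h0 | h0
      · rw [h0] at hm
        norm_num at hm
        linarith
      · exact h0
    refine ⟨C', m, out', !s, b', hm0, by omega, ?_, hb'0, hb', h'⟩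
    rw [hs', hsize]
    ring

/-- The circuit for small `ε`, with `w` the logarithm of its size up to a constant. The layers
`1, …, d - 1` raise the bias from about `ε / √n` to `6 log (1 / ε)`, the last of them without the
cap at `1`; the layer `d` is the output gate. -/
theorem exists_circuit_of_size_exp {n d : ℕ} {ε w : ℝ} (hn : 16 ≤ n) (hd : 2 ≤ d) (hε0 : 0 < ε)
    (hε : ε ≤ 1 / 2) (hw : 8 ≤ w) (hwε : 6 * Real.log (1 / ε) ≤ w)
    (hwd : 6 * Real.log (1 / ε) * (4 * √n) ≤ ε * w ^ (d - 1)) (hnw : (n : ℝ) ≤ Real.exp w)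
    (hdw : (d : ℝ) ≤ Real.exp w) :
    ∃ C : MonotoneCircuit n, IsApproxMajority ε n C.eval ∧ C.depth ≤ d ∧
      (C.size : ℝ) ≤ Real.exp (11 * w) := by
  have hn16 : (16 : ℝ) ≤ n := by exact_mod_cast hn
  have hn0 : (0 : ℝ) < n := by linarith
  have hsq : √(n : ℝ) * √n = n := Real.mul_self_sqrt hn0.le
  have hs4 : 4 ≤ √(n : ℝ) := Real.le_sqrt_of_sq_le (by norm_num; linarith)
  have hΛ : 0 ≤ 6 * Real.log (1 / ε) := by
    have : 0 ≤ Real.log (1 / ε) := Real.log_nonneg (by rw [le_div_iff₀ hε0]; linarith)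
    linarith
  -- With this choice of `r` the undecided layers contain a fraction `ε / 2` of the cube.
  set r := ⌊ε * √n / 4⌋₊ with hrdef
  have hr1 : 4 * (r : ℝ) ≤ ε * √n := by
    have := Nat.floor_le (a := ε * √n / 4) (by positivity)
    linarith
  have hr2 : ε * √n ≤ 4 * ((r : ℝ) + 1) := by
    have := Nat.lt_floor_add_one (ε * √n / 4)
    linarith
  have hr : n / 2 + 1 + r < n := by
    have h1 : 8 * (r : ℝ) ≤ n := by nlinarith
    have h2 : 8 * r ≤ n := by exact_mod_cast h1
    omega
  set ρ : ℝ := (2 * r + 1) / n with hρ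
  have hρn : ρ * n = 2 * r + 1 := by
    rw [hρ]
    field_simp
  have hρε : ε ≤ ρ * (4 * √n) := by
    refine le_of_mul_le_mul_right ?_ (by linarith : 0 < √(n : ℝ))
    have h1 : ρ * (4 * √n) * √n = 4 * (ρ * n) := by linear_combination 4 * ρ * hsq
    rw [h1, hρn]
    have : (0 : ℝ) ≤ r := Nat.cast_nonneg r
    linarith
  have hρw : 6 * Real.log (1 / ε) ≤ ρ * w ^ (d - 1) := by
    refine le_of_mul_le_mul_right (hwd.trans ?_) (by linarith : 0 < 4 * √(n : ℝ))
    have h1 : ε * w ^ (d - 1) ≤ ρ * (4 * √n) * w ^ (d - 1) := by gcongr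
    linarith
  -- The error is small compared with `ρ * exp (-2 * w)`: in the step that multiplies the bias
  -- by `w`, both densities are at least about `exp (-2 * w)`, and a factor `exp ρ` is to spare.
  set τ := Real.exp (-(4 * w)) with hτdef
  have hτ : 4 * τ * Real.exp (2 * w + 2) ≤ ρ := by
    have h1 : (4 : ℝ) ≤ Real.exp 3 := by linarith [Real.add_one_le_exp (3 : ℝ)]
    rw [hρ, le_div_iff₀ hn0]
    calc 4 * τ * Real.exp (2 * w + 2) * n
        ≤ Real.exp 3 * τ * Real.exp (2 * w + 2) * Real.exp w := by gcongr
      _ = Real.exp (5 - w) := by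
          rw [hτdef, ← Real.exp_add, ← Real.exp_add, ← Real.exp_add]
          congr 1
          ring
      _ ≤ 1 := Real.exp_le_one_iff.2 (by linarith)
      _ ≤ _ := by
          have : (0 : ℝ) ≤ r := Nat.cast_nonneg r
          linarith
  -- The least number of gates for which sampling has accuracy `τ`.
  set m := ⌈4 * ((n : ℝ) + 1) * Real.exp (8 * w)⌉₊ with hm
  have hmτ : 4 * ((n : ℝ) + 1) ≤ m * τ ^ 2 := by
    calc 4 * ((n : ℝ) + 1) = 4 * ((n : ℝ) + 1) * Real.exp (8 * w) * τ ^ 2 := by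
          have : Real.exp (8 * w) * τ ^ 2 = 1 := by
            rw [hτdef, ← Real.exp_nat_mul, ← Real.exp_add]
            norm_num
            ring
          rw [mul_assoc, this, mul_one]
      _ ≤ _ := by
          gcongr
          exact Nat.le_ceil _
  have hm1 : (1 : ℝ) ≤ m := by
    have : 0 < m := Nat.ceil_pos.2 (by positivity)
    exact_mod_cast this
  have hmle : (m : ℝ) ≤ Real.exp (9 * w + 3) := by
    have h1 := (Nat.ceil_lt_add_one (a := 4 * ((n : ℝ) + 1) * Real.exp (8 * w))
      (by positivity)).le
    have h2 : 1 ≤ Real.exp (8 * w) := Real.one_le_exp (by linarith)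
    have h3 : (8 : ℝ) ≤ Real.exp 3 := by
      have h4 := Real.add_one_le_exp (1 : ℝ)
      have h5 : Real.exp 3 = Real.exp 1 ^ 3 := by
        rw [← Real.exp_nat_mul]
        norm_num
      rw [h5]
      calc (8 : ℝ) = 2 ^ 3 := by norm_num
        _ ≤ _ := by
          gcongr
          linarith
    calc (m : ℝ) ≤ 4 * ((n : ℝ) + 1) * Real.exp (8 * w) + 1 * Real.exp (8 * w) := by linarith
      _ = (4 * (n : ℝ) + 5) * Real.exp (8 * w) := by ring
      _ ≤ (Real.exp 3 * Real.exp w) * Real.exp (8 * w) := by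
          gcongr
          nlinarith
      _ = _ := by
          rw [← Real.exp_add, ← Real.exp_add]
          congr 1
          ring
  obtain ⟨C, N, out, s, b, hN, hdepth, hsize, hb0, hb, h⟩ :=
    exists_separating_circuit hr (by linarith) (Real.exp_pos _) hτ hmτ (d - 2)
  have : Nonempty (Fin N) := ⟨⟨0, hN⟩⟩
  rw [← hρ] at h
  have hρ0 : 0 < ρ := by positivity
  have hρ1 : ρ ≤ 1 := by
    rw [hρ, div_le_one hn0]
    have : 2 * r + 1 ≤ n := by omega
    exact_mod_cast this
  have hle : ρ ≤ min 1 (ρ * w ^ (d - 2)) :=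
    le_min hρ1 (le_mul_of_one_le_right hρ0.le (one_le_pow₀ (by linarith)))
  have hgrow : 6 * Real.log (1 / ε) ≤ w * min 1 (ρ * w ^ (d - 2)) := by
    rw [mul_min_of_nonneg _ _ (by linarith)]
    refine le_min (by linarith) (hρw.trans (le_of_eq ?_))
    rw [show d - 1 = d - 2 + 1 by omega]
    ring
  obtain ⟨C', out', b', hd', hs', hb'0, hb', hbexp, h'⟩ :=
    h.exists_addLayer (ρ' := 6 * Real.log (1 / ε)) hb0 hb (by linarith)
      (hρ0.trans_le hle) (min_le_left _ _) hΛ hgrow (Real.exp_pos _) (hτ.trans hle) hmτ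
  have : Nonempty (Fin m) := ⟨⟨0, by exact_mod_cast hm1⟩⟩
  obtain ⟨C'', happrox, hd'', hs''⟩ :=
    h'.exists_approxMajority hε0 hε hb'0 hbexp hr1 (by omega)
  refine ⟨C'', happrox, by omega, ?_⟩
  have hsz : C''.size ≤ d * m := by
    have h1 : 1 ≤ m := by exact_mod_cast hm1
    obtain ⟨e, rfl⟩ : ∃ e, d = e + 2 := ⟨d - 2, by omega⟩
    rw [hs'', hs', hsize, Nat.add_sub_cancel]
    nlinarith
  calc (C''.size : ℝ) ≤ d * m := by exact_mod_cast hsz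
    _ ≤ Real.exp w * Real.exp (9 * w + 3) := by gcongr
    _ = Real.exp (10 * w + 3) := by
        rw [← Real.exp_add]
        congr 1
        ring
    _ ≤ _ := Real.exp_le_exp.2 (by linarith)

/-! ### The range of the parameters -/

theorem density_majority_le_half (n : ℕ) :
    density (fun x : Fin n → Bool => false ≠ majority n x) ≤ 1 / 2 := by
  have h1 := density_comp_equiv (fun x : Fin n → Bool => ¬ false ≠ majority n x)
    (Equiv.piCongrRight fun _ => Equiv.boolNot)
  have h2 : density (fun x : Fin n → Bool => false ≠ majority n x) ≤
      density fun x : Fin n → Bool =>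
        ¬ false ≠ majority n (Equiv.piCongrRight (fun _ => Equiv.boolNot) x) := by
    refine density_mono fun x hx => ?_
    have h3 := weight_not x
    change ¬ false ≠ decide (n < 2 * weight fun i => !x i)
    change false ≠ decide (n < 2 * weight x) at hx
    simp only [ne_eq, false_eq_decide_iff, not_not] at hx ⊢
    omega
  have h4 := density_not fun x : Fin n → Bool => false ≠ majority n x
  linarith

/-- For `d ≥ 2` the bound on `d` excludes small `n`, and it makes the `2 (d - 1)`-th root of `n`
exceed `log n`. -/
theorem bounds_of_depth_le {n d : ℕ} (hn : 3 ≤ n) (hd : 2 ≤ d)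
    (h : (d : ℝ) ≤ 1 / 100 * (Real.log n / Real.log (Real.log n))) :
    16 ≤ Real.log n ∧ (d : ℝ) ≤ Real.log n ∧
      Real.log n ≤ (n : ℝ) ^ (1 / (2 * ((d : ℝ) - 1))) := by
  have hn3 : (3 : ℝ) ≤ n := by exact_mod_cast hn
  have hn0 : (0 : ℝ) < n := by linarith
  have hd2 : (2 : ℝ) ≤ d := by exact_mod_cast hd
  set L := Real.log n with hL
  have hL1 : 1.09 ≤ L := by
    have h1 := Real.one_sub_inv_le_log_of_pos (x := 3 / Real.exp 1) (by positivity)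
    rw [Real.log_div (by norm_num) (Real.exp_pos _).ne', Real.log_exp, inv_div] at h1
    have h2 := Real.exp_one_lt_d9
    have h3 : Real.log 3 ≤ L := Real.log_le_log (by norm_num) hn3
    linarith
  have hlogL : 0.08 ≤ Real.log L := by
    have h1 := Real.one_sub_inv_le_log_of_pos (x := L) (by linarith)
    have h2 : L⁻¹ ≤ (1.09 : ℝ)⁻¹ := inv_anti₀ (by norm_num) hL1
    norm_num at h2 ⊢
    linarith
  have hdL : 100 * d * Real.log L ≤ L := by
    have h1 : 100 * (d : ℝ) ≤ L / Real.log L := by linarith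
    rwa [le_div_iff₀ (by linarith)] at h1
  have hL16 : 16 ≤ L := by nlinarith
  have hlogL1 : 1 ≤ Real.log L := by
    rw [Real.le_log_iff_exp_le (by linarith)]
    linarith [Real.exp_one_lt_d9]
  refine ⟨hL16, by nlinarith, ?_⟩
  calc L = Real.exp (Real.log L) := (Real.exp_log (by linarith)).symm
    _ ≤ Real.exp (L * (1 / (2 * ((d : ℝ) - 1)))) := by
        gcongr
        rw [mul_one_div, le_div_iff₀ (by linarith)]
        nlinarith
    _ = _ := (Real.rpow_def_of_pos hn0 _).symm

theorem mainTheorem4 :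
    ∃ c : ℝ, 0 < c ∧ ∃ K : ℝ, 0 < K ∧
      ∀ n d : ℕ, 3 ≤ n → 2 ≤ d →
        (d : ℝ) ≤ c * (Real.log (n : ℝ) / Real.log (Real.log (n : ℝ))) →
        ∀ ε : ℝ, 0 < ε →
          ∃ f : (Fin n → Bool) → Bool, IsApproxMajority ε n f ∧
            ∃ C : MonotoneCircuit n, C.eval = f ∧ C.depth ≤ d ∧
              (C.size : ℝ) ≤
                Real.exp (K * ((n : ℝ) ^ (1 / (2 * ((d : ℝ) - 1))) * Real.log (1 / ε) / ε)) := by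
  refine ⟨1 / 100, by norm_num, 264, by norm_num, fun n d hn hd hdn ε hε0 => ?_⟩
  have i₀ : Fin n := ⟨0, by omega⟩
  suffices h : ∃ C : MonotoneCircuit n, IsApproxMajority ε n C.eval ∧ C.depth ≤ d ∧
      (C.size : ℝ) ≤
        Real.exp (264 * ((n : ℝ) ^ (1 / (2 * ((d : ℝ) - 1))) * Real.log (1 / ε) / ε)) by
    obtain ⟨C, h1, h2, h3⟩ := h
    exact ⟨C.eval, h1, C, rfl, h2, h3⟩
  have hn0 : (0 : ℝ) ≤ n := Nat.cast_nonneg n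
  rcases lt_or_ge 1 ε with hε1 | hε1
  -- The bound on the size is less than `1` here, so that no gate may be used.
  · refine ⟨MonotoneCircuit.ofVar i₀, ?_, ?_, ?_⟩
    · rw [isApproxMajority_iff]
      exact (density_le_one _).trans hε1.le
    · rw [MonotoneCircuit.ofVar_depth]
      exact Nat.zero_le d
    · rw [MonotoneCircuit.ofVar_size, Nat.cast_zero]
      exact (Real.exp_pos _).le
  have hlog : 0 ≤ Real.log (1 / ε) := Real.log_nonneg (by rwa [le_div_iff₀ hε0, one_mul])
  rcases lt_or_ge (1 / 2) ε with hε2 | hε2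
  -- The constant `0`, as an OR gate without inputs.
  · set C := (MonotoneCircuit.ofVar i₀).addLayer Unit (MonotoneCircuit.kindOf false)
      (fun _ => ∅) (Sum.inr (Sum.inr ())) with hC
    have heval : ∀ x, C.eval x = false := fun x =>
      ((MonotoneCircuit.ofVar i₀).addLayer_evalNode_inr Unit _ _ false x ()).2 (by simp)
    refine ⟨C, ?_, ?_, ?_⟩
    · rw [isApproxMajority_iff]
      simp only [heval]
      exact (density_majority_le_half n).trans hε2.le
    · refine (MonotoneCircuit.addLayer_depth_le ..).trans ?_
      rw [MonotoneCircuit.ofVar_depth]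
      omega
    · rw [hC, MonotoneCircuit.addLayer_size, MonotoneCircuit.ofVar_size]
      simp only [Fintype.card_unit, zero_add, Nat.cast_one]
      exact Real.one_le_exp (by positivity)
  obtain ⟨hL16, hdL, hLN⟩ := bounds_of_depth_le hn hd hdn
  have hnpos : (0 : ℝ) < n := by
    have : 0 < n := by omega
    exact_mod_cast this
  set N := (n : ℝ) ^ (1 / (2 * ((d : ℝ) - 1))) with hN
  set Y := Real.log (1 / ε) / ε with hY
  have hd2 : (2 : ℝ) ≤ d := by exact_mod_cast hd
  have hN1 : 1 ≤ N := by linarith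
  have hlog2 : 1 / 2 ≤ Real.log (1 / ε) := by
    have h1 : Real.log 2 ≤ Real.log (1 / ε) := by
      refine Real.log_le_log (by norm_num) ?_
      rw [le_div_iff₀ hε0]
      linarith
    linarith [Real.log_two_gt_d9]
  have hY1 : 1 ≤ Y := by
    rw [hY, le_div_iff₀ hε0]
    linarith
  have hYlog : Real.log (1 / ε) ≤ Y := by
    rw [hY]
    exact le_div_self hlog hε0 hε1
  have hpow : N ^ (d - 1) = √n := by
    rw [hN, Real.sqrt_eq_rpow, ← Real.rpow_natCast, ← Real.rpow_mul hn0, Nat.cast_sub (by omega)]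
    congr 1
    have : (d : ℝ) - 1 ≠ 0 := by linarith
    push_cast
    field_simp
  have hwL : 24 * Real.log n ≤ 24 * (N * Y) := by nlinarith
  have hn16 : 16 ≤ n := by
    have h1 := Real.log_le_sub_one_of_pos hnpos
    have h2 : (16 : ℝ) ≤ n := by linarith
    exact_mod_cast h2
  have hwd : 6 * Real.log (1 / ε) * (4 * √n) ≤ ε * (24 * (N * Y)) ^ (d - 1) := by
    have hεY : ε * Y = Real.log (1 / ε) := by
      rw [hY]
      field_simp
    calc 6 * Real.log (1 / ε) * (4 * √n) = ε * (√n * (24 * Y)) := by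
          rw [← hεY]
          ring
      _ ≤ ε * (√n * (24 * Y) ^ (d - 1)) := by
          gcongr
          exact le_self_pow₀ (by linarith) (by omega)
      _ = ε * (24 * (N * Y)) ^ (d - 1) := by
          rw [← hpow, ← mul_pow]
          ring
  have hnw : (n : ℝ) ≤ Real.exp (24 * (N * Y)) :=
    (Real.exp_log hnpos).symm.trans_le (Real.exp_le_exp.2 (by linarith))
  have hdw : (d : ℝ) ≤ Real.exp (24 * (N * Y)) := by
    linarith [Real.add_one_le_exp (24 * (N * Y))]
  obtain ⟨C, h1, h2, h3⟩ := exists_circuit_of_size_exp hn16 hd hε0 hε2 (by linarith)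
    (by nlinarith) hwd hnw hdw
  refine ⟨C, h1, h2, h3.trans (le_of_eq ?_)⟩
  congr 1
  rw [hY]
  ring
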